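/- Let $\mathfrak{c}$ denote the cardinality of the continuum. Let $G$ be a group, let $\alpha\colon G\twoheadrightarrow G^{ab}=H_1(G)$ be the quotient map onto its abelianisation, and let $\iota\colon \bigoplus_{\mathfrak{c}}\mathbb{Z}\to G$ be a homomorphism. Suppose that there is an injective homomorphism $f\colon \bigoplus_{\mathfrak{c}}\mathbb{Q}\hookrightarrow H_1(G)=G^{ab}$ such that $f\circ j=\alpha\circ\iota$, where $j\colon\bigoplus_{\mathfrak{c}}\mathbb{Z}\hookrightarrow\bigoplus_{\mathfrak{c}}\mathbb{Q}$ is the canonical inclusion. Then there is an injective homomorphism of graded abelian groups \[ \Lambda^*\Bigl(\bigoplus_{\mathfrak{c}}\mathbb{Z}\Bigr)\hookrightarrow H_*(G), \] where $\Lambda^*(A)$ denotes the exterior algebra (over $\mathbb{Z}$) on an abelian group $A$ and $H_*(G)$ denotes the homology of $G$ with integer coefficients. In particular, $H_i(G)$ is uncountable for all $i\geq 1$. -/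

import Mathlib

universe u v

/-- The integral homology `H_n(G) = H_n(G; ℤ)` of a group `G`, i.e. Mathlib's group homology of the
trivial representation. Mathlib wants the coefficient ring in the universe of `G`, so that `ℤ`
appears as `ULift ℤ`. -/
noncomputable abbrev IntegralHomology (G : Type u) [Group G] (n : ℕ) : Type u :=
  groupHomology (Rep.trivial (ULift.{u} ℤ) G (ULift.{u} ℤ)) n

/-- The total integral homology `H_*(G)`, as an `ℕ`-graded abelian group. -/
abbrev TotalIntegralHomology (G : Type u) [Group G] : Type u :=
  DirectSum ℕ (fun n => IntegralHomology G n)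

/-- The canonical inclusion of `⨁_I ℤ` into `⨁_I ℚ`. -/
noncomputable def intToRat (I : Type v) : (I →₀ ℤ) →+ (I →₀ ℚ) :=
  Finsupp.mapRange.addMonoidHom (Int.castAddHom ℚ)

/-!
The proof pairs explicit bar cycles with explicit cocycles.

If `g₁, …, gₙ` are pairwise commuting elements of `G`, then the antisymmetrised bar chain
`∑ σ, sign σ • [g_{σ 1} | … | g_{σ n}]` is a cycle (`d_antisymmetrizedChain`): the inner faces cancel
under transpositions of neighbours, the two outer faces cancel under the cyclic rotation. In the
other direction, if `χ₁, …, χₙ` are additive functions from `G` to a commutative ring, then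
`[g₁ | … | gₙ] ↦ ∏ k, χₖ gₖ` vanishes on boundaries (`d_comp_prodCochain`), so that it descends to
homology. Its value on the class of an antisymmetrised chain is `det (χⱼ gᵢ)`
(`homologyPairing_antisymmetrizedClass`).

Since `ℚ` is divisible, the coordinates of `⨁_I ℚ` extend along the injection `f` to all of `Gᵃᵇ`
(`exists_character_extending_coordinate`). They give additive functions `χᵢ : G → ℚ` with
`χᵢ (ι x) = x i`. Now send the basis element `e_{i₁} ∧ … ∧ e_{iₙ}`, `i₁ < … < iₙ`, of
`Λⁿ (⨁_I ℤ)` to the class of the antisymmetrised chain on `ι e_{i₁}, …, ι e_{iₙ}`. Pairing the result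
with `χ_{j₁}, …, χ_{jₙ}` returns the coordinate at `e_{j₁} ∧ … ∧ e_{jₙ}`, so this map is injective.
-/

section BarCycles

open groupHomology CategoryTheory

variable {k G : Type u} [CommRing k] [Group G] {n : ℕ}

/-! ### Antisymmetrised bar cycles -/

/-- The antisymmetrised bar chain `∑ σ, sign σ • [g_{σ 1} | … | g_{σ n}]` with coefficients in the
trivial representation `k`. -/
noncomputable def antisymmetrizedChain (k : Type u) [CommRing k] (g : Fin n → G) :
    (Fin n → G) →₀ k :=
  ∑ σ : Equiv.Perm (Fin n), ((Equiv.Perm.sign σ : ℤ) : k) • Finsupp.single (g ∘ σ) (1 : k)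

/-- Right multiplication by the transposition pairs off summands of opposite sign. This holds over
any `k`, also in the presence of `2`-torsion. -/
theorem sum_sign_smul_eq_zero_of_swap {α M : Type*} [Fintype α] [DecidableEq α] [AddCommGroup M]
    [Module k M] {i j : α} (hij : i ≠ j) (F : Equiv.Perm α → M)
    (hF : ∀ σ, F (σ * Equiv.swap i j) = F σ) :
    ∑ σ : Equiv.Perm α, ((Equiv.Perm.sign σ : ℤ) : k) • F σ = 0 := by
  refine Finset.sum_involution (fun σ _ => σ * Equiv.swap i j) ?_ ?_ ?_ ?_
  · intro σ _
    simp [hF, Equiv.Perm.sign_mul, Equiv.Perm.sign_swap hij]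
  · intro σ _ _ h
    rw [mul_eq_left, Equiv.swap_eq_one_iff] at h
    exact hij h
  · intro σ _
    exact Finset.mem_univ _
  · intro σ _
    simp [mul_assoc]

/-- Multiplying two neighbouring entries of a commuting tuple does not see their order. -/
theorem contractNth_comp_swap (i : Fin n) (h : Fin (n + 1) → G)
    (hc : Commute (h i.castSucc) (h i.succ)) :
    Fin.contractNth i.castSucc (· * ·) (h ∘ Equiv.swap i.castSucc i.succ) =
      Fin.contractNth i.castSucc (· * ·) h := by
  funext l
  rcases lt_trichotomy (l : ℕ) (i : ℕ) with hl | hl | hl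
  · rw [Fin.contractNth_apply_of_lt _ _ _ _ (by simpa using hl),
      Fin.contractNth_apply_of_lt _ _ _ _ (by simpa using hl), Function.comp_apply,
      Equiv.swap_apply_of_ne_of_ne]
    · exact Fin.ne_of_val_ne (by simp; omega)
    · exact Fin.ne_of_val_ne (by simp; omega)
  · obtain rfl : l = i := Fin.ext hl
    rw [Fin.contractNth_apply_of_eq _ _ _ _ (by simp),
      Fin.contractNth_apply_of_eq _ _ _ _ (by simp)]
    simpa using hc.eq.symm
  · rw [Fin.contractNth_apply_of_gt _ _ _ _ (by simpa using hl),
      Fin.contractNth_apply_of_gt _ _ _ _ (by simpa using hl), Function.comp_apply,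
      Equiv.swap_apply_of_ne_of_ne]
    · exact Fin.ne_of_val_ne (by simp; omega)
    · exact Fin.ne_of_val_ne (by simp; omega)

theorem contractNth_last {α : Type*} (op : α → α → α) (h : Fin (n + 1) → α) :
    Fin.contractNth (Fin.last n) op h = h ∘ Fin.castSucc := by
  funext l
  exact Fin.contractNth_apply_of_lt _ _ _ _ l.isLt

/-- The antisymmetrised chain of a pairwise commuting family is a cycle. -/
theorem d_antisymmetrizedChain (g : Fin (n + 1) → G) (hg : ∀ i j, Commute (g i) (g j)) :
    inhomogeneousChains.d (Rep.trivial k G k) n (antisymmetrizedChain k g) = 0 := by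
  have inner (i : Fin n) : ∑ σ : Equiv.Perm (Fin (n + 1)), ((Equiv.Perm.sign σ : ℤ) : k) •
      Finsupp.single (Fin.contractNth i.castSucc (· * ·) (g ∘ σ)) (1 : k) = 0 := by
    refine sum_sign_smul_eq_zero_of_swap (i := i.castSucc) (j := i.succ)
      (Fin.castSucc_lt_succ).ne _ fun σ => ?_
    rw [Equiv.Perm.coe_mul, ← Function.comp_assoc, contractNth_comp_swap i (g ∘ σ) (hg _ _)]
  -- The last face of `σ` rotated is the zeroth face of `σ`.
  have rot (σ : Equiv.Perm (Fin (n + 1))) :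
      (g ∘ ⇑(σ * finRotate (n + 1))) ∘ Fin.castSucc = fun i => (g ∘ σ) i.succ := by
    funext i
    simp [finRotate_apply]
  have outer : ∑ σ : Equiv.Perm (Fin (n + 1)), ((Equiv.Perm.sign σ : ℤ) : k) •
        Finsupp.single ((g ∘ σ) ∘ Fin.castSucc) (1 : k) =
      (-1 : k) ^ n • ∑ σ : Equiv.Perm (Fin (n + 1)), ((Equiv.Perm.sign σ : ℤ) : k) •
        Finsupp.single (fun i => (g ∘ σ) i.succ) (1 : k) := by
    rw [← Equiv.sum_comp (Equiv.mulRight (finRotate (n + 1))), Finset.smul_sum]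
    refine Finset.sum_congr rfl fun σ _ => ?_
    rw [Equiv.coe_mulRight, rot, Equiv.Perm.sign_mul, sign_finRotate, smul_smul]
    congr 1
    simp [mul_comm]
  have expand : inhomogeneousChains.d (Rep.trivial k G k) n (antisymmetrizedChain k g) =
      ∑ σ : Equiv.Perm (Fin (n + 1)), ((Equiv.Perm.sign σ : ℤ) : k) •
        (Finsupp.single (fun i => (g ∘ σ) i.succ) (1 : k) +
          ∑ j : Fin (n + 1), (-1 : k) ^ ((j : ℕ) + 1) •
            Finsupp.single (Fin.contractNth j (· * ·) (g ∘ σ)) (1 : k)) := by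
    rw [antisymmetrizedChain]
    erw [map_sum]
    refine Finset.sum_congr rfl fun σ _ => ?_
    erw [map_smul, inhomogeneousChains.d_single]
    rfl
  rw [expand]
  simp only [smul_add, Finset.smul_sum, Finset.sum_add_distrib]
  rw [Finset.sum_comm]
  simp only [smul_comm _ ((-1 : k) ^ _), ← Finset.smul_sum]
  rw [Fin.sum_univ_castSucc]
  simp only [inner, smul_zero, Finset.sum_const_zero, zero_add, contractNth_last, outer,
    smul_smul, Fin.val_last]
  rw [← pow_add, show n + 1 + n = 2 * n + 1 by ring, pow_succ, pow_mul]
  simp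

/-- The homology class of the antisymmetrised chain of a pairwise commuting family. The degree
`0` is separate only because no differential leaves it. -/
noncomputable def antisymmetrizedClass (k : Type u) [CommRing k] :
    {n : ℕ} → (g : Fin n → G) → (∀ i j, Commute (g i) (g j)) →
      groupHomology (Rep.trivial k G k) n
  | 0, g, _ => π (Rep.trivial k G k) 0
      (cyclesMk 0 0 (by simp) (antisymmetrizedChain k g)
        (by rw [HomologicalComplex.shape _ _ _ (by simp)]; rfl))
  | n + 1, g, hg => π (Rep.trivial k G k) (n + 1)
      (cyclesMk (n + 1) n (by simp) (antisymmetrizedChain k g)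
        (by rw [inhomogeneousChains.d_def]; exact d_antisymmetrizedChain g hg))

/-! ### Products of additive characters as cocycles -/

/-- The linear form `[g₁ | … | gₙ] ↦ ∏ i, χ i (g i)` on bar chains, with values in a `k`-algebra. -/
noncomputable def prodCochain {B : Type u} [CommRing B] [Algebra k B]
    (χ : Fin n → Additive G →+ B) :
    ModuleCat.of k ((Fin n → G) →₀ Rep.trivial k G k) ⟶ ModuleCat.of k B :=
  ModuleCat.ofHom (Finsupp.linearCombination k fun g : Fin n → G =>
    ∏ i, χ i (Additive.ofMul (g i)))

theorem prodCochain_single {B : Type u} [CommRing B] [Algebra k B]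
    (χ : Fin n → Additive G →+ B) (g : Fin n → G) (a : k) :
    prodCochain (k := k) χ (Finsupp.single g a : (Fin n → G) →₀ k) =
      a • ∏ i, χ i (Additive.ofMul (g i)) :=
  Finsupp.linearCombination_single k a g

/-- A product of additive functions on an inner face splits as the sum of two products with one
entry omitted. -/
theorem prod_contractNth_castSucc {B : Type*} [CommRing B] (χ : Fin n → Additive G →+ B)
    (g : Fin (n + 1) → G) (j : Fin n) :
    ∏ i, χ i (Additive.ofMul (Fin.contractNth j.castSucc (· * ·) g i)) =
      ∏ i, χ i (Additive.ofMul (g (j.castSucc.succAbove i))) +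
        ∏ i, χ i (Additive.ofMul (g (j.succ.succAbove i))) := by
  symm
  refine Finset.prod_add_prod_eq (Finset.mem_univ j) ?_ ?_ ?_
  · rw [Fin.contractNth_apply_of_eq _ _ _ _ (by simp), ofMul_mul, map_add, add_comm]
    simp
  · intro i _ hi
    rw [Fin.contractNth_apply_of_ne _ _ _ _ (by simpa [Fin.ext_iff, eq_comm] using hi)]
  · intro i _ hi
    have hne : (i : ℕ) ≠ j := fun h => hi (Fin.ext h)
    rw [Fin.contractNth_apply_of_ne _ _ _ _ (by simpa using hne.symm)]
    congr 3
    rcases lt_or_gt_of_ne hne with h | h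
    · rw [Fin.succAbove_of_castSucc_lt _ _ (Fin.lt_def.2 (by simp; omega)),
        Fin.succAbove_of_castSucc_lt _ _ (Fin.lt_def.2 (by simp; omega))]
    · rw [Fin.succAbove_of_le_castSucc _ _ (Fin.le_def.2 (by simp; omega)),
        Fin.succAbove_of_le_castSucc _ _ (Fin.le_def.2 (by simp; omega))]

theorem sum_neg_one_pow_smul_add_succ {M : Type*} [AddCommGroup M] [Module k M] (n : ℕ)
    (T : Fin (n + 1) → M) :
    ∑ j : Fin n, (-1 : k) ^ ((j : ℕ) + 1) • (T j.castSucc + T j.succ) =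
      -T 0 - (-1 : k) ^ (n + 1) • T (Fin.last n) := by
  induction n with
  | zero => simp
  | succ n ih =>
    rw [Fin.sum_univ_castSucc]
    have := ih (fun j => T j.castSucc)
    simp only [Fin.succ_castSucc, Fin.val_castSucc] at this ⊢
    rw [this, pow_succ _ (n + 1)]
    simp only [Fin.castSucc_zero, Fin.val_last, Fin.succ_last, smul_add, mul_neg, mul_one, neg_smul]
    abel

/-- A product of additive functions is a cocycle: the values on the faces telescope. -/
theorem d_comp_prodCochain {B : Type u} [CommRing B] [Algebra k B] (χ : Fin n → Additive G →+ B) :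
    inhomogeneousChains.d (Rep.trivial k G k) n ≫ prodCochain χ = 0 := by
  refine ModuleCat.hom_ext (Finsupp.lhom_ext fun g a => ?_)
  change prodCochain χ (inhomogeneousChains.d (Rep.trivial k G k) n (Finsupp.single g a)) = 0
  have key : ∏ i, χ i (Additive.ofMul (g i.succ)) + ∑ j : Fin (n + 1), (-1 : k) ^ ((j : ℕ) + 1) •
      ∏ i, χ i (Additive.ofMul (Fin.contractNth j (· * ·) g i)) = 0 := by
    rw [Fin.sum_univ_castSucc]
    simp only [prod_contractNth_castSucc, Fin.val_castSucc]
    rw [sum_neg_one_pow_smul_add_succ (k := k) n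
      (fun j => ∏ i, χ i (Additive.ofMul (g (j.succAbove i)))), contractNth_last]
    simp
  rw [inhomogeneousChains.d_single]
  erw [map_add, map_sum, prodCochain_single]
  trans (a : k) • (∏ i, χ i (Additive.ofMul (g i.succ)) +
    ∑ j : Fin (n + 1), (-1 : k) ^ ((j : ℕ) + 1) •
      ∏ i, χ i (Additive.ofMul (Fin.contractNth j (· * ·) g i)))
  · rw [smul_add, Finset.smul_sum]
    congr 1
    refine Finset.sum_congr rfl fun j _ => ?_
    erw [map_smul, prodCochain_single]
    rw [smul_comm]
  · rw [key, smul_zero]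

/-- Evaluation of homology classes against the cocycle `∏ i, χ i`. -/
noncomputable def homologyPairing {B : Type u} [CommRing B] [Algebra k B]
    (χ : Fin n → Additive G →+ B) :
    groupHomology (Rep.trivial k G k) n ⟶ ModuleCat.of k B :=
  (inhomogeneousChains (Rep.trivial k G k)).homologyι n ≫
    (inhomogeneousChains (Rep.trivial k G k)).descOpcycles (prodCochain χ) (n + 1) (by simp)
      (by rw [inhomogeneousChains.d_def]; exact d_comp_prodCochain χ)

theorem homologyPairing_π {B : Type u} [CommRing B] [Algebra k B] (χ : Fin n → Additive G →+ B)
    (z : cycles (Rep.trivial k G k) n) :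
    homologyPairing χ (π (Rep.trivial k G k) n z) =
      prodCochain χ (iCycles (Rep.trivial k G k) n z) := by
  have h : π (Rep.trivial k G k) n ≫ homologyPairing χ =
      iCycles (Rep.trivial k G k) n ≫ prodCochain χ := by
    rw [homologyPairing]
    erw [HomologicalComplex.homology_π_ι_assoc, HomologicalComplex.p_descOpcycles]
  exact congr($h z)

theorem prodCochain_antisymmetrizedChain {B : Type u} [CommRing B] [Algebra k B]
    (χ : Fin n → Additive G →+ B) (g : Fin n → G) :
    prodCochain (k := k) χ (antisymmetrizedChain k g) =
      (Matrix.of fun i j => χ j (Additive.ofMul (g i))).det := by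
  rw [antisymmetrizedChain, Matrix.det_apply']
  erw [map_sum]
  refine Finset.sum_congr rfl fun σ _ => ?_
  erw [map_smul, prodCochain_single]
  simp [Algebra.smul_def]

/-- The product of `χ₁, …, χₙ` takes the value `det (χⱼ gᵢ)` on the antisymmetrised class of
`g₁, …, gₙ`. -/
theorem homologyPairing_antisymmetrizedClass {B : Type u} [CommRing B] [Algebra k B]
    (χ : Fin n → Additive G →+ B) (g : Fin n → G) (hg : ∀ i j, Commute (g i) (g j)) :
    homologyPairing χ (antisymmetrizedClass k g hg) =
      (Matrix.of fun i j => χ j (Additive.ofMul (g i))).det := by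
  rw [← prodCochain_antisymmetrizedChain (k := k)]
  cases n <;>
  · rw [antisymmetrizedClass, homologyPairing_π, iCycles_mk]

end BarCycles

/-! ### The exterior algebra of a free abelian group in the homology of `G` -/

/-- As `ℚ` is an injective abelian group, the coordinates of `⨁_I ℚ` extend along `f` to characters
of `G`. -/
theorem exists_character_extending_coordinate {G : Type u} [Group G] {I : Type v}
    (f : (I →₀ ℚ) →+ Additive (Abelianization G)) (hf : Function.Injective f) (i : I) :
    ∃ χ : Additive G →+ ℚ, ∀ (g : G) (x : I →₀ ℚ),
      f x = Additive.ofMul (Abelianization.of g) → χ (Additive.ofMul g) = x i := by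
  obtain ⟨p, hp⟩ := (Module.Baer.of_divisible ℚ).extension_property_addMonoidHom f hf
    (Finsupp.applyAddHom i)
  refine ⟨p.comp (MonoidHom.toAdditive Abelianization.of), fun g x hx => ?_⟩
  have := DFunLike.congr_fun hp x
  rw [AddMonoidHom.comp_apply, hx] at this
  exact this

theorem uncountable_powersetCard {I : Type*} [Uncountable I] {n : ℕ} (hn : 1 ≤ n) :
    Uncountable (Set.powersetCard I n) := by
  refine ⟨fun _ => not_countable (α := I) ?_⟩
  rw [← Set.countable_univ_iff]
  refine (Set.countable_iUnion fun s : Set.powersetCard I n => s.1.countable_toSet).mono fun i _ => ?_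
  obtain ⟨t, hit, ht⟩ := Infinite.exists_superset_card_eq {i} n (by simpa using hn)
  exact Set.mem_iUnion.2 ⟨⟨t, ht⟩, hit (by simp)⟩

section Embedding

-- Lets `ULift ℚ` be an algebra over the coefficient ring `ULift ℤ` of `IntegralHomology`.
attribute [local instance] ULift.algebra'

open Module Set Set.powersetCard

variable {G : Type u} [Group G] {I : Type v} [LinearOrder I]

/-- The homomorphism `Λⁿ (⨁_I ℤ) → Hₙ(G)` sending `e_{i₁} ∧ … ∧ e_{iₙ}` with `i₁ < … < iₙ` to the
antisymmetrised class of `ι e_{i₁}, …, ι e_{iₙ}`. -/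
noncomputable def exteriorPowerToHomology (ι : Multiplicative (I →₀ ℤ) →* G) (n : ℕ) :
    ⋀[ℤ]^n (I →₀ ℤ) →ₗ[ℤ] IntegralHomology G n :=
  ((Finsupp.basisSingleOne (R := ℤ) (ι := I)).exteriorPower n).constr ℤ fun s =>
    antisymmetrizedClass (ULift.{u} ℤ)
      (fun l => ι (Multiplicative.ofAdd (Finsupp.single (ofFinEmbEquiv.symm s l) 1)))
      fun _ _ => (Commute.all _ _).map ι

/-- The pairing with the product of the characters `χ i`, `i ∈ s`, reads off the coordinate at `s`.
The values are in `ULift ℚ` for reasons of universes. -/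
theorem homologyPairing_exteriorPowerToHomology (ι : Multiplicative (I →₀ ℤ) →* G)
    (χ : I → Additive G →+ ℚ)
    (hχ : ∀ i (x : I →₀ ℤ), χ i (Additive.ofMul (ι (Multiplicative.ofAdd x))) = x i)
    {n : ℕ} (s : powersetCard I n) (x : ⋀[ℤ]^n (I →₀ ℤ)) :
    homologyPairing (k := ULift.{u} ℤ) (B := ULift.{u} ℚ)
        (fun l => AddEquiv.ulift.symm.toAddMonoidHom.comp (χ (ofFinEmbEquiv.symm s l)))
        (exteriorPowerToHomology ι n x) =
      (((Finsupp.basisSingleOne (R := ℤ) (ι := I)).exteriorPower n).repr x s : ULift.{u} ℚ) := by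
  set b := Finsupp.basisSingleOne (R := ℤ) (ι := I)
  let P := homologyPairing (k := ULift.{u} ℤ) (B := ULift.{u} ℚ)
    (fun l => AddEquiv.ulift.symm.toAddMonoidHom.comp (χ (ofFinEmbEquiv.symm s l)))
  suffices h : P.hom.toAddMonoidHom.toIntLinearMap ∘ₗ exteriorPowerToHomology ι n =
      (Int.castAddHom (ULift.{u} ℚ)).toIntLinearMap ∘ₗ (b.exteriorPower n).coord s from
    DFunLike.congr_fun h x
  refine (b.exteriorPower n).ext fun t => ?_
  trans P (antisymmetrizedClass (ULift.{u} ℤ)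
      (fun l => ι (Multiplicative.ofAdd (Finsupp.single (ofFinEmbEquiv.symm t l) 1)))
      fun _ _ => (Commute.all _ _).map ι)
  · exact congrArg P (Basis.constr_basis ..)
  rw [show P = homologyPairing _ from rfl, homologyPairing_antisymmetrizedClass,
    exteriorPower.basis_coord, exteriorPower.basis_apply,
    LinearMap.comp_apply, exteriorPower.ιMulti_family, exteriorPower.ιMultiDual_apply_ιMulti]
  refine Eq.trans ?_ (Int.cast_det _).symm
  congr 1
  ext i j
  simp only [Matrix.of_apply, AddMonoidHom.comp_apply, hχ, Function.comp_apply, b,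
    Basis.coord_apply, Finsupp.coe_basisSingleOne, Finsupp.basisSingleOne_repr]
  rfl

theorem exteriorPowerToHomology_injective (ι : Multiplicative (I →₀ ℤ) →* G)
    (χ : I → Additive G →+ ℚ)
    (hχ : ∀ i (x : I →₀ ℤ), χ i (Additive.ofMul (ι (Multiplicative.ofAdd x))) = x i) (n : ℕ) :
    Function.Injective (exteriorPowerToHomology ι n) := by
  intro x y hxy
  refine ((Finsupp.basisSingleOne (R := ℤ) (ι := I)).exteriorPower n).repr.injective
    (Finsupp.ext fun s => ?_)
  have h := homologyPairing_exteriorPowerToHomology ι χ hχ s x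
  rw [hxy, homologyPairing_exteriorPowerToHomology ι χ hχ s y] at h
  simpa using congrArg ULift.down h.symm

end Embedding

theorem mainTheorem7 (G : Type u) [Group G] (I : Type v) (hI : Cardinal.mk I = Cardinal.continuum)
    (ι : Multiplicative (I →₀ ℤ) →* G)
    (f : (I →₀ ℚ) →+ Additive (Abelianization G)) (hf : Function.Injective f)
    (hcomm : ∀ x : I →₀ ℤ,
      f (intToRat I x) = Additive.ofMul (Abelianization.of (ι (Multiplicative.ofAdd x)))) :
    (∃ Φ : ExteriorAlgebra ℤ (I →₀ ℤ) →+ TotalIntegralHomology G,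
      Function.Injective Φ ∧
      ∀ n : ℕ, ∀ x ∈ ⋀[ℤ]^n (I →₀ ℤ),
        ∃ y : IntegralHomology G n, Φ x = DirectSum.of (fun n => IntegralHomology G n) n y) ∧
    ∀ i : ℕ, 1 ≤ i → Uncountable (IntegralHomology G i) := by
  classical
  -- The order only serves to list the elements of a finite subset of `I`.
  let : LinearOrder I := linearOrderOfSTO WellOrderingRel
  choose χ h using exists_character_extending_coordinate f hf
  have hχ (i : I) (x : I →₀ ℤ) :
      χ i (Additive.ofMul (ι (Multiplicative.ofAdd x))) = x i := by
    rw [h i _ _ (hcomm x)]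
    simp [intToRat]
  have hinj := exteriorPowerToHomology_injective ι χ hχ
  have : Uncountable I := by
    rw [← Cardinal.aleph0_lt_mk_iff, hI]
    exact Cardinal.aleph0_lt_continuum
  refine ⟨⟨(DirectSum.map fun n => (exteriorPowerToHomology ι n).toAddMonoidHom).comp
    (DirectSum.decomposeAddEquiv fun n => ⋀[ℤ]^n (I →₀ ℤ)).toAddMonoidHom, ?_, ?_⟩, ?_⟩
  · exact ((DirectSum.map_injective _).2 hinj).comp (AddEquiv.injective _)
  · intro n x hx
    refine ⟨exteriorPowerToHomology ι n ⟨x, hx⟩, ?_⟩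
    change DirectSum.map _ (DirectSum.decompose (fun n => ⋀[ℤ]^n (I →₀ ℤ)) x) = _
    rw [DirectSum.decompose_of_mem (fun n => ⋀[ℤ]^n (I →₀ ℤ)) hx, DirectSum.map_of]
    rfl
  · intro n hn
    have := uncountable_powersetCard (I := I) hn
    exact ((hinj n).comp ((Finsupp.basisSingleOne (R := ℤ) (ι := I)).exteriorPower n).injective
      ).uncountable
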